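/- Let $\mathcal S,\mathcal A$ be finite sets, $\mathcal P(s'\mid s,a)$ transition probabilities, $\mathcal R:\mathcal S\times\mathcal A\to\mathbb R$ a reward function with $|\mathcal R(s,a)|\le \mathcal R_{max}$ for all $(s,a)$, where $\mathcal R_{max}>0$, $\gamma\in(0,1)$ a discount factor, and $\pi$ a policy with $\pi(a\mid s)>0$ for all $(s,a)$. Suppose that the Markov chain on $\mathcal S\times\mathcal A$ with transition matrix $P((s,a),(s',a'))=\mathcal P(s'\mid s,a)\,\pi(a'\mid s')$ is ergodic (irreducible and aperiodic), let $\eta_\pi$ be its stationary distribution, and let $m>0$, $r\in(0,1)$ be constants of uniform geometric mixing: $$\sup_{s,a} d_{TV}\big(\mathbb P(s_t=\cdot,a_t=\cdot\mid s_0=s,a_0=a),\eta_\pi\big)\le m r^t\qquad (t=0,1,2,\dots),$$ where $d_{TV}$ is total variation distance. For $\epsilon>0$ put $\tau^{\mathrm{mix}}(\epsilon)=\min\{t\in\{0,1,2,\dots\} : m r^t\le\epsilon\}$. Let $\phi:\mathcal S\times\mathcal A\to\mathbb R^N$ be a feature map with linearly independent coordinate functions $\phi_1,\dots,\phi_N$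 and $\|\phi(s,a)\|^2\le 1$ for all $(s,a)$, and write $Q_w(s,a)=w^\top\phi(s,a)$ and $\|f\|_{\eta_\pi}^2=\sum_{s,a}\eta_\pi(s,a)f(s,a)^2$. Let $R>0$ and let $\Theta\subseteq\mathbb R^N$ be a closed convex set with $\|w\|\le R$ for all $w\in\Theta$. Let $w^*\in\Theta$ solve the projected Bellman equation, that is, $Q_{w^*}$ is the projection, with respect to $\|\cdot\|_{\eta_\pi}$, of $\mathbb T^\pi Q_{w^*}$ onto $\{Q_w: w\in\mathbb R^N\}$, where $$(\mathbb T^\pi Q)(s,a)=\mathcal R(s,a)+\gamma\sum_{s',a'}\mathcal P(s'\mid s,a)\,\pi(a'\mid s')\,Q(s',a').$$ Let $(s_k,a_k)_{k\ge0}$ be a Markov chain with transition matrix $P$ and an arbitrary initial distribution (not necessarily the stationary one). Let $K\ge1$, $\alpha=1/\sqrt K$, $w_0\in\Theta$, and let the projected TD(0) iterates be $$w_{k+1}=\mathrm{Proj}_\Theta\Big[w_k+\alpha\big(\mathcal R(s_k,a_k)+\gamma Q_{w_k}(s_{k+1},a_{k+1})-Q_{w_k}(s_k,a_k)\big)\phi(s_k,a_k)\Big],\qquad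 \bar w_K=\frac1K\sum_{k=0}^{K-1}w_k,$$ where $\mathrm{Proj}_\Theta$ is the Euclidean projection onto $\Theta$. Then, with $F=\mathcal R_{max}+2R$, $$\mathbb E\big[\|Q_{w^*}-Q_{\bar w_K}\|_{\eta_\pi}^2\big]\le\frac{\|w^*-w_0\|^2+F^2\big(17+12\,\tau^{\mathrm{mix}}(1/\sqrt K)\big)}{2(1-\gamma)\sqrt K}+\frac{10F^2m}{(1-r)(1-\gamma)K}.$$ -/

import Mathlib

namespace TDZero

/-- A finite Markov decision process: the transition probabilities `trans s a s'` of moving to `s'`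
when action `a` is performed in state `s`, and the reward `reward s a`. -/
structure MDP (S A : Type*) [Fintype S] where
  trans : S → A → S → ℝ
  reward : S → A → ℝ
  trans_nonneg : ∀ s a s', 0 ≤ trans s a s'
  trans_sum : ∀ s a, ∑ s', trans s a s' = 1

/-- A stochastic policy: `prob s a` is the probability of action `a` in state `s`. -/
structure Policy (S A : Type*) [Fintype A] where
  prob : S → A → ℝ
  prob_nonneg : ∀ s a, 0 ≤ prob s a
  prob_sum : ∀ s, ∑ a, prob s a = 1

section Chain

variable {S A : Type*} [Fintype S] [Fintype A]

/-- Transition matrix of the chain of state-action pairs,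
from `(s, a)` to `(s', a')` with probability `trans s a s' * prob s' a'`. -/
def chainMatrix (M : MDP S A) (π : Policy S A) : Matrix (S × A) (S × A) ℝ :=
  Matrix.of fun x y => M.trans x.1 x.2 y.1 * π.prob y.1 y.2

/-- The Bellman operator of the policy `π` with discount factor `γ`. -/
def bellman (M : MDP S A) (π : Policy S A) (γ : ℝ) (Q : S × A → ℝ) : S × A → ℝ :=
  fun x => M.reward x.1 x.2 +
    γ * ∑ s', ∑ a', M.trans x.1 x.2 s' * π.prob s' a' * Q (s', a')

end Chain

section FiniteChain

variable {E : Type*} [Fintype E]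

/-- The greatest common divisor of the return times of every state is one. -/
def IsAperiodic [DecidableEq E] (P : Matrix E E ℝ) : Prop :=
  ∀ x : E, ∀ d : ℕ, (∀ t : ℕ, 0 < t → 0 < (P ^ t) x x → d ∣ t) → d = 1

/-- Ergodicity of a finite chain: irreducible and aperiodic. -/
def IsErgodic [DecidableEq E] (P : Matrix E E ℝ) : Prop :=
  P.IsIrreducible ∧ IsAperiodic P

/-- `η` is a stationary probability distribution of the chain with transition matrix `P`. -/
structure IsStationary (P : Matrix E E ℝ) (η : E → ℝ) : Prop where
  nonneg : ∀ x, 0 ≤ η x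
  sum_eq_one : ∑ x, η x = 1
  stationary : ∀ y, ∑ x, η x * P x y = η y

/-- Total variation distance of two distributions on a finite set. -/
noncomputable def tvDist (p q : E → ℝ) : ℝ :=
  (1 / 2) * ∑ x, |p x - q x|

/-- Uniform geometric mixing with constants `m`, `r`: row `x` of `P ^ t` is the law at time `t`
of the chain started at `x`. -/
def MixesGeometrically [DecidableEq E] (P : Matrix E E ℝ) (η : E → ℝ) (m r : ℝ) : Prop :=
  ∀ (t : ℕ) (x : E), tvDist (fun y => (P ^ t) x y) η ≤ m * r ^ t

/-- The mixing time `min {t | m r ^ t ≤ ε}`. -/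
noncomputable def mixingTime (m r ε : ℝ) : ℕ :=
  sInf {t : ℕ | m * r ^ t ≤ ε}

/-- `X` is a Markov chain with transition matrix `P`, with an arbitrary law of `X 0`. -/
structure IsMarkovChain {Ω : Type*} [MeasurableSpace Ω] (μ : MeasureTheory.Measure Ω)
    (X : ℕ → Ω → E) (P : Matrix E E ℝ) : Prop where
  measurable : ∀ (t : ℕ) (x : E), MeasurableSet {ω | X t ω = x}
  law : ∀ (n : ℕ) (x : ℕ → E),
    μ.real {ω | ∀ t ≤ n, X t ω = x t} =
      μ.real {ω | X 0 ω = x 0} * ∏ t ∈ Finset.range n, P (x t) (x (t + 1))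

/-- The squared `η`-weighted norm of a function on a finite set. -/
def sqNorm (η : E → ℝ) (f : E → ℝ) : ℝ :=
  ∑ x, η x * f x ^ 2

/-- The linear value function `x ↦ wᵀ φ(x)`. -/
noncomputable def linQ {N : ℕ} (φ : E → EuclideanSpace ℝ (Fin N))
    (w : EuclideanSpace ℝ (Fin N)) : E → ℝ :=
  fun x => inner ℝ w (φ x)

end FiniteChain

/-- The nearest point of `Θ` to `x`, for `Θ` nonempty, closed and convex. -/
noncomputable def proj {V : Type*} [NormedAddCommGroup V] (Θ : Set V) (x : V) : V :=
  Classical.epsilon fun p => p ∈ Θ ∧ ∀ y ∈ Θ, ‖x - p‖ ≤ ‖x - y‖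

theorem proj_spec {V : Type*} [NormedAddCommGroup V] [ProperSpace V] {Θ : Set V}
    (hne : Θ.Nonempty) (hcl : IsClosed Θ) (x : V) :
    proj Θ x ∈ Θ ∧ ∀ y ∈ Θ, ‖x - proj Θ x‖ ≤ ‖x - y‖ := by
  have h : ∃ p, p ∈ Θ ∧ ∀ y ∈ Θ, ‖x - p‖ ≤ ‖x - y‖ := by
    obtain ⟨p, hp, hd⟩ := hcl.exists_infDist_eq_dist hne x
    refine ⟨p, hp, fun y hy => ?_⟩
    rw [← dist_eq_norm, ← dist_eq_norm, ← hd]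
    exact Metric.infDist_le_dist_of_mem hy
  exact Classical.epsilon_spec h

section TD

variable {S A : Type*} [Fintype S] [Fintype A] {N : ℕ}

/-- `w` solves the projected Bellman equation `Φ w = Proj (T (Φ w))`: `Φ w` is the best
approximation of `T (Φ w)`, in the `η`-weighted norm, among the functions `Φ v`. -/
def IsProjectedBellmanSolution (M : MDP S A) (π : Policy S A) (γ : ℝ) (η : S × A → ℝ)
    (φ : S × A → EuclideanSpace ℝ (Fin N)) (w : EuclideanSpace ℝ (Fin N)) : Prop :=
  ∀ v : EuclideanSpace ℝ (Fin N),
    sqNorm η (bellman M π γ (linQ φ w) - linQ φ w) ≤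
      sqNorm η (bellman M π γ (linQ φ w) - linQ φ v)

/-- The TD(0) semi-gradient at `w` for the observed transition from `x` to `y`. -/
noncomputable def semiGradient (M : MDP S A) (γ : ℝ) (φ : S × A → EuclideanSpace ℝ (Fin N))
    (x y : S × A) (w : EuclideanSpace ℝ (Fin N)) : EuclideanSpace ℝ (Fin N) :=
  (M.reward x.1 x.2 + γ * linQ φ w y - linQ φ w x) • φ x

/-- The iterates of projected TD(0) with constant step size `α`, started at `w₀`, along the
trajectory `x` of state-action pairs. -/
noncomputable def tdIterate (M : MDP S A) (γ : ℝ) (φ : S × A → EuclideanSpace ℝ (Fin N))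
    (Θ : Set (EuclideanSpace ℝ (Fin N))) (α : ℝ) (w₀ : EuclideanSpace ℝ (Fin N))
    (x : ℕ → S × A) : ℕ → EuclideanSpace ℝ (Fin N)
  | 0 => w₀
  | k + 1 => proj Θ (tdIterate M γ φ Θ α w₀ x k +
      α • semiGradient M γ φ (x k) (x (k + 1)) (tdIterate M γ φ Θ α w₀ x k))

/-- The average of the first `K` iterates `w_0, …, w_{K-1}`. -/
noncomputable def tdAverage (M : MDP S A) (γ : ℝ) (φ : S × A → EuclideanSpace ℝ (Fin N))
    (Θ : Set (EuclideanSpace ℝ (Fin N))) (α : ℝ) (w₀ : EuclideanSpace ℝ (Fin N))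
    (x : ℕ → S × A) (K : ℕ) : EuclideanSpace ℝ (Fin N) :=
  (1 / (K : ℝ)) • ∑ k ∈ Finset.range K, tdIterate M γ φ Θ α w₀ x k

end TD

end TDZero

/-! Write g for the sampled semi-gradient and ḡ for its stationary mean. Two facts make ḡ behave
like the gradient of a convex function: ḡ(w*) is orthogonal to every direction (projected Bellman
equation), and P does not expand the η-norm, so ⟨ḡ(w), w* - w⟩ ≥ (1-γ)‖Q_{w*} - Q_w‖²
(`sqNorm_le_inner_meanGradient`). As `proj` moves no point away from w*, expanding ‖w* - w_{k+1}‖²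
bounds 2α(1-γ)‖Q_{w*} - Q_{w_k}‖² by a telescoping difference, plus α²F², plus 2α times the noise ⟨g
- ḡ, w_k - w*⟩ (`sqNorm_le_of_tdStep`). Convexity passes from the iterates to their average.

The noise is not centred, since w_k depends on the recent path. Replace w_k by w_{k-j}: iterates
move by at most αF per step and the noise is 6F-Lipschitz, which costs 6F²αj. Given the path up to
k-j, the iterate w_{k-j} is fixed and the law of (s_k, a_k) is m r^j-close to η, under which the
noise has mean zero, which costs 4F²m r^j (`integral_gradientNoise_le`). Take j = τ when k ≥ τ and j
= k otherwise; the latter contributes a geometric series, hence the 1/K term. -/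

namespace TDZero

open MeasureTheory

/-! ### Integrals of finitely valued random variables. -/

section FiniteValued

variable {Ω β : Type*} [MeasurableSpace Ω] {μ : Measure Ω} [Fintype β]

theorem integrable_comp_of_finite [IsFiniteMeasure μ] {T : Ω → β}
    (hT : ∀ b, MeasurableSet {ω | T ω = b}) (f : β → ℝ) :
    Integrable (fun ω => f (T ω)) μ := by
  let _ : MeasurableSpace β := ⊤
  have hTm : Measurable T := measurable_to_countable' fun b => hT b
  exact (Integrable.of_finite (μ := μ.map T) (f := f)).comp_measurable hTm

theorem integral_comp_of_finite [IsFiniteMeasure μ] {T : Ω → β}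
    (hT : ∀ b, MeasurableSet {ω | T ω = b}) (f : β → ℝ) :
    ∫ ω, f (T ω) ∂μ = ∑ b, μ.real {ω | T ω = b} * f b := by
  let _ : MeasurableSpace β := ⊤
  have hTm : Measurable T := measurable_to_countable' fun b => hT b
  rw [← integral_map (φ := T) (f := f) hTm.aemeasurable
    (measurable_of_finite f).aestronglyMeasurable, integral_fintype Integrable.of_finite]
  refine Finset.sum_congr rfl fun b _ => ?_
  rw [map_measureReal_apply hTm (measurableSet_singleton b), smul_eq_mul]
  rfl

end FiniteValued

/-! ### The Markov property for functions of the path. -/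

section MarkovProperty

variable {E : Type*}

/-- The infinite path which follows `p` and then stays at its last point. -/
def extendPath {n : ℕ} (p : Fin (n + 1) → E) : ℕ → E :=
  fun t => p ⟨min t n, by omega⟩

/-- The first `n + 1` points of a path. -/
def initialPath (n : ℕ) (x : ℕ → E) : Fin (n + 1) → E := fun t => x t

theorem extendPath_apply_of_le {n t : ℕ} (p : Fin (n + 1) → E) (h : t ≤ n) :
    extendPath p t = p ⟨t, by omega⟩ := by
  simp [extendPath, min_eq_left h]

theorem initialPath_eq_iff {n : ℕ} (x : ℕ → E) (p : Fin (n + 1) → E) :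
    initialPath n x = p ↔ ∀ t ≤ n, x t = extendPath p t := by
  constructor
  · rintro rfl t ht
    rw [extendPath_apply_of_le _ ht]
    rfl
  · intro h
    funext t
    have := h t (by omega)
    rw [extendPath_apply_of_le _ (by omega)] at this
    exact this

/-- Lets a function of the first n + 1 states be treated as a function on a finite type, so that its
integral is a finite sum. -/
theorem dependsOn_extendPath_initialPath {γ : Type*} {n : ℕ} {f : (ℕ → E) → γ}
    (hf : DependsOn f (Set.Iic n)) (x : ℕ → E) :
    f (extendPath (initialPath n x)) = f x :=
  hf fun t ht => (((initialPath_eq_iff x _).1 rfl) t ht).symm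

variable {Ω : Type*} [MeasurableSpace Ω] {μ : Measure Ω}
  {X : ℕ → Ω → E} {P : Matrix E E ℝ}

theorem IsMarkovChain.measurableSet_initialPath (hX : IsMarkovChain μ X P) (n : ℕ)
    (p : Fin (n + 1) → E) : MeasurableSet {ω | initialPath n (fun t => X t ω) = p} := by
  have : {ω | initialPath n (fun t => X t ω) = p} = ⋂ t, {ω | X (t : Fin (n + 1)) ω = p t} := by
    ext ω
    simp [initialPath, funext_iff]
  rw [this]
  exact MeasurableSet.iInter fun t => hX.measurable _ _

theorem IsMarkovChain.integrable [Fintype E] [IsFiniteMeasure μ] (hX : IsMarkovChain μ X P) {n : ℕ}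
    {f : (ℕ → E) → ℝ} (hf : DependsOn f (Set.Iic n)) :
    Integrable (fun ω => f fun t => X t ω) μ := by
  classical
  have := integrable_comp_of_finite (μ := μ) (hX.measurableSet_initialPath n)
    (fun p => f (extendPath p))
  simpa only [dependsOn_extendPath_initialPath hf] using this

theorem IsMarkovChain.measureReal_succ (hX : IsMarkovChain μ X P) (n : ℕ) (x : ℕ → E) (y : E) :
    μ.real {ω | (∀ t ≤ n, X t ω = x t) ∧ X (n + 1) ω = y} =
      μ.real {ω | ∀ t ≤ n, X t ω = x t} * P (x n) y := by
  set z : ℕ → E := Function.update x (n + 1) y with hz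
  have hzt : ∀ t ≤ n, z t = x t := fun t ht => by
    rw [hz, Function.update_of_ne (by omega)]
  have hset : {ω | (∀ t ≤ n, X t ω = x t) ∧ X (n + 1) ω = y} =
      {ω | ∀ t ≤ n + 1, X t ω = z t} := by
    ext ω
    constructor
    · rintro ⟨h, h'⟩ t ht
      rcases Nat.le_succ_iff.1 ht with ht | rfl
      · rw [h t ht, hzt t ht]
      · rw [h', hz, Function.update_self]
    · intro h
      refine ⟨fun t ht => ?_, ?_⟩
      · rw [h t (by omega), hzt t ht]
      · rw [h (n + 1) le_rfl, hz, Function.update_self]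
  have hprod : ∏ t ∈ Finset.range n, P (z t) (z (t + 1)) =
      ∏ t ∈ Finset.range n, P (x t) (x (t + 1)) := by
    refine Finset.prod_congr rfl fun t ht => ?_
    have := Finset.mem_range.1 ht
    rw [hzt t (by omega), hzt (t + 1) (by omega)]
  rw [hset, hX.law, hX.law, Finset.prod_range_succ, hprod, hzt 0 (by omega), hzt n le_rfl,
    hz, Function.update_self, mul_assoc]

/-- The one-step Markov property. -/
theorem IsMarkovChain.integral_succ [Fintype E] [IsFiniteMeasure μ] (hX : IsMarkovChain μ X P) {n : ℕ}
    {f : (ℕ → E) → E → ℝ} (hf : DependsOn f (Set.Iic n)) :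
    ∫ ω, f (fun t => X t ω) (X (n + 1) ω) ∂μ =
      ∫ ω, ∑ y, P (X n ω) y * f (fun t => X t ω) y ∂μ := by
  classical
  have hdep : DependsOn (fun x : ℕ → E => ∑ y, P (x n) y * f x y) (Set.Iic n) := by
    intro x x' h
    simp only [hf h, h n (Set.mem_Iic.2 le_rfl)]
  have hmeas : ∀ q : (Fin (n + 1) → E) × E,
      MeasurableSet {ω | (initialPath n (fun t => X t ω), X (n + 1) ω) = q} := by
    rintro ⟨p, y⟩
    have : {ω | (initialPath n (fun t => X t ω), X (n + 1) ω) = (p, y)} =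
        {ω | initialPath n (fun t => X t ω) = p} ∩ {ω | X (n + 1) ω = y} := by
      ext ω
      simp
    rw [this]
    exact (hX.measurableSet_initialPath n p).inter (hX.measurable _ _)
  -- Both sides become sums over initial paths and are compared atom by atom.
  have h1 := integral_comp_of_finite (μ := μ) hmeas (fun q => f (extendPath q.1) q.2)
  have h2 := integral_comp_of_finite (μ := μ) (hX.measurableSet_initialPath n)
    (fun p => ∑ y, P (extendPath p n) y * f (extendPath p) y)
  simp only [dependsOn_extendPath_initialPath hf] at h1
  simp only [fun x => dependsOn_extendPath_initialPath hdep x] at h2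
  rw [h1, h2, Fintype.sum_prod_type]
  refine Finset.sum_congr rfl fun p _ => ?_
  rw [Finset.mul_sum]
  refine Finset.sum_congr rfl fun y _ => ?_
  simp only [Prod.mk.injEq, initialPath_eq_iff]
  rw [hX.measureReal_succ, mul_assoc]

/-- The Markov property at several steps. -/
theorem IsMarkovChain.integral_add [Fintype E] [DecidableEq E] [IsFiniteMeasure μ] (hX : IsMarkovChain μ X P)
    {n : ℕ} (j : ℕ) {f : (ℕ → E) → E → ℝ} (hf : DependsOn f (Set.Iic n)) :
    ∫ ω, f (fun t => X t ω) (X (n + j) ω) ∂μ =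
      ∫ ω, ∑ y, (P ^ j) (X n ω) y * f (fun t => X t ω) y ∂μ := by
  induction j generalizing f with
  | zero => simp [Matrix.one_apply]
  | succ j ih =>
    have hf' : DependsOn f (Set.Iic (n + j)) :=
      hf.mono (Set.Iic_subset_Iic.2 (by omega))
    have hg : DependsOn (fun x z => ∑ y, P z y * f x y) (Set.Iic n) := by
      intro x x' h
      simp only [hf h]
    -- The last of the j + 1 steps is averaged out first; what remains is a function of the state at
    -- time n + j, hence the induction over all f.
    rw [← add_assoc, hX.integral_succ hf', ih hg]
    refine integral_congr_ae (Filter.Eventually.of_forall fun ω => ?_)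
    simp only [pow_succ, Matrix.mul_apply, Finset.mul_sum, Finset.sum_mul]
    rw [Finset.sum_comm]
    simp only [mul_assoc]

end MarkovProperty

end TDZero

namespace TDZero

section Chain

variable {S A : Type*} [Fintype S] [Fintype A]

theorem chainMatrix_nonneg (M : MDP S A) (π : Policy S A) (x y : S × A) :
    0 ≤ chainMatrix M π x y :=
  mul_nonneg (M.trans_nonneg _ _ _) (π.prob_nonneg _ _)

theorem chainMatrix_sum (M : MDP S A) (π : Policy S A) (x : S × A) :
    ∑ y, chainMatrix M π x y = 1 := by
  simp only [chainMatrix, Matrix.of_apply, Fintype.sum_prod_type, ← Finset.mul_sum,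
    π.prob_sum, mul_one, M.trans_sum]

theorem bellman_eq (M : MDP S A) (π : Policy S A) (γ : ℝ) (Q : S × A → ℝ) (x : S × A) :
    bellman M π γ Q x = M.reward x.1 x.2 + γ * ∑ y, chainMatrix M π x y * Q y := by
  simp only [bellman, chainMatrix, Matrix.of_apply, Fintype.sum_prod_type]

end Chain

/-! ### Euclidean projection onto a convex set. -/

section Projection

variable {V : Type*} [NormedAddCommGroup V] [InnerProductSpace ℝ V] [ProperSpace V] {Θ : Set V}

/-- The angle at the nearest point p is not acute: ⟨x - p, y - p⟩ ≤ 0. -/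
theorem norm_sub_proj_le (hcl : IsClosed Θ) (hconv : Convex ℝ Θ) {y : V} (hy : y ∈ Θ) (x : V) :
    ‖y - proj Θ x‖ ≤ ‖y - x‖ := by
  obtain ⟨hp, hmin⟩ := proj_spec ⟨y, hy⟩ hcl x
  have : Nonempty Θ := ⟨⟨y, hy⟩⟩
  have hinf : ‖x - proj Θ x‖ = ⨅ w : Θ, ‖x - w‖ :=
    le_antisymm (le_ciInf fun w => hmin w w.2)
      (ciInf_le ⟨0, by rintro _ ⟨w, rfl⟩; exact norm_nonneg _⟩ (⟨_, hp⟩ : Θ))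
  have hin := (norm_eq_iInf_iff_real_inner_le_zero hconv hp).1 hinf y hy
  have hsq : ‖y - x‖ ^ 2 = ‖y - proj Θ x‖ ^ 2 - 2 * inner ℝ (x - proj Θ x) (y - proj Θ x) +
      ‖x - proj Θ x‖ ^ 2 := by
    rw [real_inner_comm, ← norm_sub_sq_real]
    congr 2
    abel
  refine (pow_le_pow_iff_left₀ (norm_nonneg _) (norm_nonneg _) two_ne_zero).1 ?_
  nlinarith [sq_nonneg ‖x - proj Θ x‖]

end Projection

/-! ### Inequalities in the stationary norm. -/

section Weighted

variable {E : Type*} [Fintype E] {η : E → ℝ}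

/-- The weighted norm of an average is at most the average of the weighted norms. -/
theorem sqNorm_average_le (hη : ∀ x, 0 ≤ η x) (f : ℕ → E → ℝ) {K : ℕ} (hK : 0 < K) :
    sqNorm η (fun x => (1 / (K : ℝ)) * ∑ k ∈ Finset.range K, f k x) ≤
      (1 / (K : ℝ)) * ∑ k ∈ Finset.range K, sqNorm η (f k) := by
  have hK' : (0 : ℝ) < K := by exact_mod_cast hK
  simp only [sqNorm]
  rw [Finset.sum_comm, Finset.mul_sum]
  refine Finset.sum_le_sum fun x _ => ?_
  have h := sq_sum_le_card_mul_sum_sq (s := Finset.range K) (f := fun k => f k x)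
  rw [Finset.card_range] at h
  rw [← Finset.mul_sum, mul_left_comm]
  refine mul_le_mul_of_nonneg_left ?_ (hη x)
  rw [mul_pow]
  calc (1 / (K : ℝ)) ^ 2 * (∑ k ∈ Finset.range K, f k x) ^ 2
      ≤ (1 / (K : ℝ)) ^ 2 * (K * ∑ k ∈ Finset.range K, f k x ^ 2) := by gcongr
    _ = (1 / (K : ℝ)) * ∑ k ∈ Finset.range K, f k x ^ 2 := by field_simp

/-- The transition operator of a chain is a contraction of the norm weighted by a stationary
distribution. -/
theorem IsStationary.sum_mul_le_sqNorm {P : Matrix E E ℝ} (hη : IsStationary P η)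
    (hP : ∀ x y, 0 ≤ P x y) (hP1 : ∀ x, ∑ y, P x y = 1) (f : E → ℝ) :
    ∑ x, η x * ((∑ y, P x y * f y) * f x) ≤ sqNorm η f := by
  have h1 : ∑ x, η x * ((∑ y, P x y * f y) * f x) ≤
      ∑ x, ∑ y, η x * P x y * ((1 / 2) * f y ^ 2 + (1 / 2) * f x ^ 2) := by
    refine Finset.sum_le_sum fun x _ => ?_
    rw [Finset.sum_mul, Finset.mul_sum]
    refine Finset.sum_le_sum fun y _ => ?_
    have := mul_nonneg (hη.nonneg x) (hP x y)
    -- f y * f x ≤ (f y² + f x²)/2; by stationarity both halves have the same η-mean.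
    nlinarith [mul_nonneg this (sq_nonneg (f y - f x))]
  have h2 : ∑ x, ∑ y, η x * P x y * ((1 / 2) * f y ^ 2) = (1 / 2) * sqNorm η f := by
    rw [Finset.sum_comm, sqNorm, Finset.mul_sum]
    refine Finset.sum_congr rfl fun y _ => ?_
    rw [← Finset.sum_mul, hη.stationary]
    ring
  have h3 : ∑ x, ∑ y, η x * P x y * ((1 / 2) * f x ^ 2) = (1 / 2) * sqNorm η f := by
    rw [sqNorm, Finset.mul_sum]
    refine Finset.sum_congr rfl fun x _ => ?_
    rw [← Finset.sum_mul, ← Finset.mul_sum, hP1]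
    ring
  simp only [mul_add, Finset.sum_add_distrib] at h1
  linarith

/-- The weights form the law of a stationary transition, so bounds on the semi-gradient and on its
increments pass to the mean. -/
theorem norm_sum_sum_smul_le {V : Type*} [NormedAddCommGroup V] [NormedSpace ℝ V]
    {P : Matrix E E ℝ} (hη : ∀ x, 0 ≤ η x) (hη1 : ∑ x, η x = 1)
    (hP : ∀ x y, 0 ≤ P x y) (hP1 : ∀ x, ∑ y, P x y = 1) {v : E → E → V} {C : ℝ}
    (hv : ∀ x y, ‖v x y‖ ≤ C) : ‖∑ x, ∑ y, (η x * P x y) • v x y‖ ≤ C := by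
  have h : ∑ x, ∑ y, η x * P x y * C = C := by
    simp only [← Finset.sum_mul, ← Finset.mul_sum, hP1, mul_one, hη1, one_mul]
  rw [← h]
  refine (norm_sum_le _ _).trans (Finset.sum_le_sum fun x _ => ?_)
  refine (norm_sum_le _ _).trans (Finset.sum_le_sum fun y _ => ?_)
  have h0 := mul_nonneg (hη x) (hP x y)
  rw [norm_smul, Real.norm_of_nonneg h0]
  exact mul_le_mul_of_nonneg_left (hv x y) h0

/-- A bounded function with mean zero under `η` has small mean under a distribution close
to `η`. -/
theorem abs_sum_mul_le_tvDist {p h : E → ℝ} (h0 : ∑ x, η x * h x = 0) {C : ℝ}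
    (hC : ∀ x, |h x| ≤ C) : |∑ x, p x * h x| ≤ 2 * tvDist p η * C := by
  have : ∑ x, p x * h x = ∑ x, (p x - η x) * h x := by
    simp only [sub_mul, Finset.sum_sub_distrib, h0, sub_zero]
  rw [this, tvDist, ← mul_assoc, show (2 : ℝ) * (1 / 2) = 1 by norm_num, one_mul,
    Finset.sum_mul]
  refine (Finset.abs_sum_le_sum_abs _ _).trans (Finset.sum_le_sum fun x _ => ?_)
  rw [abs_mul]
  exact mul_le_mul_of_nonneg_left (hC x) (abs_nonneg _)

end Weighted

section LinearValue

variable {E : Type*} {N : ℕ} (φ : E → EuclideanSpace ℝ (Fin N))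

theorem linQ_sub (v w : EuclideanSpace ℝ (Fin N)) : linQ φ (v - w) = linQ φ v - linQ φ w := by
  funext x
  exact inner_sub_left _ _ _

variable {φ}

theorem abs_linQ_le (hφ : ∀ x, ‖φ x‖ ≤ 1) (w : EuclideanSpace ℝ (Fin N)) (x : E) :
    |linQ φ w x| ≤ ‖w‖ :=
  (abs_real_inner_le_norm _ _).trans (mul_le_of_le_one_right (norm_nonneg _) (hφ x))

end LinearValue

/-! ### The semi-gradient, its mean and its noise. -/

section SemiGradient

variable {S A : Type*} [Fintype S] {N : ℕ} (M : MDP S A) (γ : ℝ)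
  (φ : S × A → EuclideanSpace ℝ (Fin N))

variable {M γ φ}

theorem norm_semiGradient_le (hγ0 : 0 ≤ γ) (hγ1 : γ ≤ 1) {Rmax R : ℝ}
    (hr : ∀ s a, |M.reward s a| ≤ Rmax) (hφ : ∀ x, ‖φ x‖ ≤ 1) {w : EuclideanSpace ℝ (Fin N)}
    (hw : ‖w‖ ≤ R) (x y : S × A) : ‖semiGradient M γ φ x y w‖ ≤ Rmax + 2 * R := by
  rw [semiGradient, norm_smul, Real.norm_eq_abs]
  refine (mul_le_of_le_one_right (abs_nonneg _) (hφ x)).trans ?_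
  have h1 := abs_le.1 (hr x.1 x.2)
  have h2 := abs_le.1 ((abs_linQ_le hφ w x).trans hw)
  have h3 : |γ * linQ φ w y| ≤ R := by
    rw [abs_mul, abs_of_nonneg hγ0]
    exact (mul_le_of_le_one_left (abs_nonneg _) hγ1).trans ((abs_linQ_le hφ w y).trans hw)
  have h4 := abs_le.1 h3
  rw [abs_le]
  constructor <;> linarith [h1.1, h1.2, h2.1, h2.2, h4.1, h4.2]

/-- The reward cancels, leaving a map linear in v - w of norm at most 1 + γ ≤ 2. -/
theorem norm_semiGradient_sub_le (hγ0 : 0 ≤ γ) (hγ1 : γ ≤ 1) (hφ : ∀ x, ‖φ x‖ ≤ 1)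
    (v w : EuclideanSpace ℝ (Fin N)) (x y : S × A) :
    ‖semiGradient M γ φ x y v - semiGradient M γ φ x y w‖ ≤ 2 * ‖v - w‖ := by
  have h : semiGradient M γ φ x y v - semiGradient M γ φ x y w =
      (γ * linQ φ (v - w) y - linQ φ (v - w) x) • φ x := by
    rw [semiGradient, semiGradient, ← sub_smul, linQ_sub]
    simp only [Pi.sub_apply]
    congr 1
    ring
  rw [h, norm_smul, Real.norm_eq_abs]
  refine (mul_le_of_le_one_right (abs_nonneg _) (hφ x)).trans ?_
  refine (abs_sub _ _).trans ?_
  rw [abs_mul, abs_of_nonneg hγ0]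
  have h1 := abs_linQ_le hφ (v - w) x
  have h2 := mul_le_of_le_one_left (abs_nonneg (linQ φ (v - w) y)) hγ1
  have h3 := abs_linQ_le hφ (v - w) y
  linarith

variable (M γ φ)

variable [Fintype A] (π : Policy S A) (η : S × A → ℝ)

/-- The mean of the semi-gradient at `w` under the stationary distribution. -/
noncomputable def meanGradient (w : EuclideanSpace ℝ (Fin N)) : EuclideanSpace ℝ (Fin N) :=
  ∑ x, ∑ y, (η x * chainMatrix M π x y) • semiGradient M γ φ x y w

/-- The noise of the semi-gradient at `w` in the direction `w - v`. -/
noncomputable def gradientNoise (v : EuclideanSpace ℝ (Fin N)) (x y : S × A)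
    (w : EuclideanSpace ℝ (Fin N)) : ℝ :=
  inner ℝ (semiGradient M γ φ x y w - meanGradient M γ φ π η w) (w - v)

variable {M π γ η φ}

/-- Averaging over the next state turns the sampled TD error into the Bellman error. -/
theorem inner_meanGradient (w d : EuclideanSpace ℝ (Fin N)) :
    inner ℝ (meanGradient M γ φ π η w) d =
      ∑ x, η x * ((bellman M π γ (linQ φ w) x - linQ φ w x) * linQ φ d x) := by
  rw [meanGradient, sum_inner]
  refine Finset.sum_congr rfl fun x _ => ?_
  have h : ∀ y, inner ℝ ((η x * chainMatrix M π x y) • semiGradient M γ φ x y w) d =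
      η x * (chainMatrix M π x y * (M.reward x.1 x.2 - linQ φ w x) * linQ φ d x +
        γ * (chainMatrix M π x y * linQ φ w y) * linQ φ d x) := by
    intro y
    rw [semiGradient, real_inner_smul_left, real_inner_smul_left, real_inner_comm]
    simp only [linQ]
    ring
  rw [sum_inner]
  simp only [h]
  rw [← Finset.mul_sum, Finset.sum_add_distrib, ← Finset.sum_mul, ← Finset.sum_mul,
    ← Finset.sum_mul, ← Finset.mul_sum, chainMatrix_sum, bellman_eq]
  ring

/-- The Bellman error at a solution of the projected Bellman equation is orthogonal to the linear
value functions. -/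
theorem IsProjectedBellmanSolution.inner_meanGradient_eq_zero {w : EuclideanSpace ℝ (Fin N)}
    (h : IsProjectedBellmanSolution M π γ η φ w) (d : EuclideanSpace ℝ (Fin N)) :
    inner ℝ (meanGradient M γ φ π η w) d = 0 := by
  set b : ℝ := inner ℝ (meanGradient M γ φ π η w) d with hb
  -- Optimality against w + t d; a quadratic that is nonnegative for every t and vanishes at 0 has
  -- no linear term.
  have key : ∀ t : ℝ, 0 ≤ -(2 * t * b) + t ^ 2 * sqNorm η (linQ φ d) := by
    intro t
    have ht := h (w + t • d)
    have e : sqNorm η (bellman M π γ (linQ φ w) - linQ φ (w + t • d)) =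
        sqNorm η (bellman M π γ (linQ φ w) - linQ φ w) - 2 * t * b +
          t ^ 2 * sqNorm η (linQ φ d) := by
      rw [hb, inner_meanGradient]
      simp only [sqNorm, Finset.mul_sum, ← Finset.sum_sub_distrib, ← Finset.sum_add_distrib]
      refine Finset.sum_congr rfl fun x _ => ?_
      have : linQ φ (w + t • d) x = linQ φ w x + t * linQ φ d x := by
        simp only [linQ, inner_add_left, real_inner_smul_left]
      simp only [Pi.sub_apply, this]
      ring
    linarith
  set c := sqNorm η (linQ φ d)
  by_contra hne
  have hbpos : 0 < b ^ 2 := by positivity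
  -- Near the minimiser b / c, but with a denominator that is positive even when c = 0.
  have h1 := key (b / (|c| + 1))
  have hc : 0 < |c| + 1 := by positivity
  have h2 : -(2 * (b / (|c| + 1)) * b) + (b / (|c| + 1)) ^ 2 * c =
      b ^ 2 / (|c| + 1) ^ 2 * (c - 2 * (|c| + 1)) := by
    field_simp
    ring
  rw [h2] at h1
  have h3 : 0 < b ^ 2 / (|c| + 1) ^ 2 := by positivity
  have h4 : c - 2 * (|c| + 1) < 0 := by linarith [le_abs_self c, abs_nonneg c]
  exact absurd h1 (not_le.2 (mul_neg_of_pos_of_neg h3 h4))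

/-- The mean semi-gradient points towards the solution of the projected Bellman equation. -/
theorem IsProjectedBellmanSolution.sqNorm_le_inner_meanGradient (hγ0 : 0 ≤ γ)
    (hη : IsStationary (chainMatrix M π) η) {v : EuclideanSpace ℝ (Fin N)}
    (h : IsProjectedBellmanSolution M π γ η φ v) (w : EuclideanSpace ℝ (Fin N)) :
    (1 - γ) * sqNorm η (linQ φ v - linQ φ w) ≤ inner ℝ (meanGradient M γ φ π η w) (v - w) := by
  have h0 := h.inner_meanGradient_eq_zero (v - w)
  have hc := hη.sum_mul_le_sqNorm (chainMatrix_nonneg M π) (chainMatrix_sum M π) (linQ φ (v - w))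
  -- The mean gradient is affine, so rewards cancel in the difference and only I - γP remains.
  have e : inner ℝ (meanGradient M γ φ π η w) (v - w) -
      inner ℝ (meanGradient M γ φ π η v) (v - w) = sqNorm η (linQ φ (v - w)) -
        γ * ∑ x, η x * ((∑ y, chainMatrix M π x y * linQ φ (v - w) y) * linQ φ (v - w) x) := by
    rw [inner_meanGradient, inner_meanGradient, ← Finset.sum_sub_distrib, sqNorm, Finset.mul_sum,
      ← Finset.sum_sub_distrib]
    refine Finset.sum_congr rfl fun x _ => ?_
    simp only [bellman_eq, linQ_sub, Pi.sub_apply, mul_sub, Finset.sum_sub_distrib]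
    ring
  rw [← linQ_sub]
  nlinarith [mul_le_mul_of_nonneg_left hc hγ0]

section Noise

variable {F : ℝ} {v w u : EuclideanSpace ℝ (Fin N)}

theorem norm_meanGradient_le (hη : IsStationary (chainMatrix M π) η)
    (hg : ∀ x y, ‖semiGradient M γ φ x y w‖ ≤ F) : ‖meanGradient M γ φ π η w‖ ≤ F :=
  norm_sum_sum_smul_le hη.nonneg hη.sum_eq_one (chainMatrix_nonneg M π) (chainMatrix_sum M π) hg

theorem norm_meanGradient_sub_le (hγ0 : 0 ≤ γ) (hγ1 : γ ≤ 1) (hφ : ∀ x, ‖φ x‖ ≤ 1)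
    (hη : IsStationary (chainMatrix M π) η) (v w : EuclideanSpace ℝ (Fin N)) :
    ‖meanGradient M γ φ π η v - meanGradient M γ φ π η w‖ ≤ 2 * ‖v - w‖ := by
  simp only [meanGradient, ← Finset.sum_sub_distrib, ← smul_sub]
  exact norm_sum_sum_smul_le hη.nonneg hη.sum_eq_one (chainMatrix_nonneg M π)
    (chainMatrix_sum M π) (norm_semiGradient_sub_le hγ0 hγ1 hφ v w)

theorem abs_gradientNoise_le (hη : IsStationary (chainMatrix M π) η)
    (hg : ∀ x y, ‖semiGradient M γ φ x y w‖ ≤ F) (hd : ‖w - v‖ ≤ F) (x y : S × A) :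
    |gradientNoise M γ φ π η v x y w| ≤ 2 * F ^ 2 := by
  refine (abs_real_inner_le_norm _ _).trans ?_
  have h1 : ‖semiGradient M γ φ x y w - meanGradient M γ φ π η w‖ ≤ 2 * F :=
    (norm_sub_le _ _).trans (by linarith [hg x y, norm_meanGradient_le hη hg])
  calc _ ≤ 2 * F * F := mul_le_mul h1 hd (norm_nonneg _) ((norm_nonneg _).trans h1)
    _ = 2 * F ^ 2 := by ring

/-- 6F = 2F + 4F: the direction changes against a vector of norm at most 2F, then g - ḡ, which is
4-Lipschitz, changes against a direction of norm at most F. -/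
theorem gradientNoise_sub_le (hγ0 : 0 ≤ γ) (hγ1 : γ ≤ 1) (hφ : ∀ x, ‖φ x‖ ≤ 1)
    (hη : IsStationary (chainMatrix M π) η)
    (hg : ∀ x y, ‖semiGradient M γ φ x y w‖ ≤ F) (hd : ‖u - v‖ ≤ F) (x y : S × A) :
    gradientNoise M γ φ π η v x y w - gradientNoise M γ φ π η v x y u ≤ 6 * F * ‖w - u‖ := by
  set g := semiGradient M γ φ x y
  set G := meanGradient M γ φ π η with hG
  have e : gradientNoise M γ φ π η v x y w - gradientNoise M γ φ π η v x y u =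
      inner ℝ (g w - G w) (w - u) + inner ℝ ((g w - g u) - (G w - G u)) (u - v) := by
    simp only [gradientNoise, inner_sub_left, inner_sub_right, g, G]
    ring
  have h1 : ‖g w - G w‖ ≤ 2 * F :=
    (norm_sub_le _ _).trans (by linarith [hg x y, norm_meanGradient_le hη hg])
  have h2 : ‖(g w - g u) - (G w - G u)‖ ≤ 4 * ‖w - u‖ :=
    (norm_sub_le _ _).trans (by
      linarith [norm_semiGradient_sub_le (M := M) hγ0 hγ1 hφ w u x y,
        norm_meanGradient_sub_le hγ0 hγ1 hφ hη w u])
  have h3 := (real_inner_le_norm (g w - G w) (w - u)).trans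
    (mul_le_mul_of_nonneg_right h1 (norm_nonneg _))
  have h4 := (real_inner_le_norm ((g w - g u) - (G w - G u)) (u - v)).trans
    (mul_le_mul h2 hd (norm_nonneg _) (by positivity))
  rw [e]
  linarith

/-- The parameter w is fixed here, independent of the transition; for the current iterate the noise
need not be centred. -/
theorem sum_stationary_gradientNoise (hη : IsStationary (chainMatrix M π) η) :
    ∑ x, η x * ∑ y, chainMatrix M π x y * gradientNoise M γ φ π η v x y w = 0 := by
  have h1 : ∑ x, ∑ y, η x * chainMatrix M π x y = 1 := by
    simp only [← Finset.mul_sum, chainMatrix_sum, mul_one, hη.sum_eq_one]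
  have h2 : ∑ x, ∑ y, η x * chainMatrix M π x y * inner ℝ (semiGradient M γ φ x y w) (w - v) =
      inner ℝ (meanGradient M γ φ π η w) (w - v) := by
    simp only [meanGradient, sum_inner, real_inner_smul_left]
  simp only [gradientNoise, inner_sub_left _ _ (w - v), mul_sub, Finset.mul_sum,
    Finset.sum_sub_distrib, ← mul_assoc]
  simp only [mul_assoc, ← Finset.mul_sum, ← Finset.sum_mul, chainMatrix_sum, one_mul,
    hη.sum_eq_one]
  simp only [Finset.mul_sum, ← mul_assoc]
  rw [h2, sub_self]

/-- The conditional mean of the noise after `t` steps of a mixing chain. -/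
theorem sum_gradientNoise_le [DecidableEq S] [DecidableEq A] {m r : ℝ}
    (hη : IsStationary (chainMatrix M π) η)
    (hmix : MixesGeometrically (chainMatrix M π) η m r)
    (hg : ∀ x y, ‖semiGradient M γ φ x y w‖ ≤ F) (hd : ‖w - v‖ ≤ F) (t : ℕ) (z : S × A) :
    ∑ x, (chainMatrix M π ^ t) z x *
      ∑ y, chainMatrix M π x y * gradientNoise M γ φ π η v x y w ≤ 4 * F ^ 2 * (m * r ^ t) := by
  have hC : ∀ x, |∑ y, chainMatrix M π x y * gradientNoise M γ φ π η v x y w| ≤ 2 * F ^ 2 := by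
    intro x
    refine (Finset.abs_sum_le_sum_abs _ _).trans ?_
    calc ∑ y, |chainMatrix M π x y * gradientNoise M γ φ π η v x y w|
        ≤ ∑ y, chainMatrix M π x y * (2 * F ^ 2) := by
          refine Finset.sum_le_sum fun y _ => ?_
          rw [abs_mul, abs_of_nonneg (chainMatrix_nonneg M π x y)]
          exact mul_le_mul_of_nonneg_left (abs_gradientNoise_le hη hg hd x y)
            (chainMatrix_nonneg M π x y)
      _ = 2 * F ^ 2 := by rw [← Finset.sum_mul, chainMatrix_sum, one_mul]
  -- Twice the total variation times the uniform bound 2F² gives 4F²m r^t.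
  have h := (le_abs_self _).trans (abs_sum_mul_le_tvDist
    (p := fun x => (chainMatrix M π ^ t) z x) (sum_stationary_gradientNoise hη) hC)
  refine h.trans ?_
  nlinarith [mul_le_mul_of_nonneg_right (hmix t z) (sq_nonneg F)]

end Noise

end SemiGradient

end TDZero

namespace TDZero

open MeasureTheory

/-! ### The iterates along the chain. -/

section Iterates

variable {S A : Type*} [Fintype S] {N : ℕ} {M : MDP S A} {γ : ℝ}
  {φ : S × A → EuclideanSpace ℝ (Fin N)} {Θ : Set (EuclideanSpace ℝ (Fin N))} {α F : ℝ}
  {w₀ : EuclideanSpace ℝ (Fin N)}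

theorem tdIterate_mem (hcl : IsClosed Θ) (hw₀ : w₀ ∈ Θ) (x : ℕ → S × A) (k : ℕ) :
    tdIterate M γ φ Θ α w₀ x k ∈ Θ := by
  cases k with
  | zero => exact hw₀
  | succ k => exact (proj_spec ⟨w₀, hw₀⟩ hcl _).1

/-- Adaptedness: the Markov property at time k may treat this iterate as a constant. -/
theorem dependsOn_tdIterate (k : ℕ) :
    DependsOn (fun x => tdIterate M γ φ Θ α w₀ x k) (Set.Iic k) := by
  induction k with
  | zero => intro x x' _; rfl
  | succ k ih =>
    intro x x' h
    have h1 := ih fun t ht => h t (Set.Iic_subset_Iic.2 k.le_succ ht)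
    have h2 := h k (Set.mem_Iic.2 k.le_succ)
    have h3 := h (k + 1) (Set.mem_Iic.2 le_rfl)
    simp only [tdIterate] at h1 ⊢
    rw [h1, h2, h3]

theorem dependsOn_tdAverage (K : ℕ) :
    DependsOn (fun x => tdAverage M γ φ Θ α w₀ x K) (Set.Iic K) := by
  intro x x' h
  simp only [tdAverage]
  congr 1
  refine Finset.sum_congr rfl fun k hk => ?_
  exact dependsOn_tdIterate k fun t ht =>
    h t (Set.Iic_subset_Iic.2 (Finset.mem_range.1 hk).le ht)

theorem norm_tdIterate_add_sub_le (hcl : IsClosed Θ) (hconv : Convex ℝ Θ) (hw₀ : w₀ ∈ Θ)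
    (hα : 0 ≤ α) (hg : ∀ w ∈ Θ, ∀ x y, ‖semiGradient M γ φ x y w‖ ≤ F) (x : ℕ → S × A)
    (n j : ℕ) :
    ‖tdIterate M γ φ Θ α w₀ x (n + j) - tdIterate M γ φ Θ α w₀ x n‖ ≤ α * F * j := by
  induction j with
  | zero => simp
  | succ j ih =>
    set w := tdIterate M γ φ Θ α w₀ x (n + j) with hw
    have hwΘ : w ∈ Θ := tdIterate_mem hcl hw₀ x _
    have hstep : ‖tdIterate M γ φ Θ α w₀ x (n + j + 1) - w‖ ≤ α * F := by
      rw [norm_sub_rev]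
      refine (norm_sub_proj_le hcl hconv hwΘ _).trans ?_
      rw [← hw, sub_add_cancel_left, norm_neg, norm_smul, Real.norm_of_nonneg hα]
      exact mul_le_mul_of_nonneg_left (hg w hwΘ _ _) hα
    have := norm_sub_le_norm_sub_add_norm_sub (tdIterate M γ φ Θ α w₀ x (n + j + 1)) w
      (tdIterate M γ φ Θ α w₀ x n)
    rw [← add_assoc]
    push_cast
    linarith

variable [Fintype A] {π : Policy S A} {η : S × A → ℝ} {v : EuclideanSpace ℝ (Fin N)}

/-- Progress of one step of projected TD(0). -/
theorem sqNorm_le_of_tdStep (hγ0 : 0 ≤ γ) (hη : IsStationary (chainMatrix M π) η)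
    (hsol : IsProjectedBellmanSolution M π γ η φ v) (hv : v ∈ Θ)
    (hcl : IsClosed Θ) (hconv : Convex ℝ Θ) (hw₀ : w₀ ∈ Θ) (hα : 0 ≤ α)
    (hg : ∀ w ∈ Θ, ∀ x y, ‖semiGradient M γ φ x y w‖ ≤ F) (x : ℕ → S × A) (k : ℕ) :
    2 * α * (1 - γ) * sqNorm η (linQ φ v - linQ φ (tdIterate M γ φ Θ α w₀ x k)) ≤
      ‖v - tdIterate M γ φ Θ α w₀ x k‖ ^ 2 - ‖v - tdIterate M γ φ Θ α w₀ x (k + 1)‖ ^ 2 +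
        α ^ 2 * F ^ 2 +
        2 * α * gradientNoise M γ φ π η v (x k) (x (k + 1)) (tdIterate M γ φ Θ α w₀ x k) := by
  set w := tdIterate M γ φ Θ α w₀ x k with hw
  have hwΘ : w ∈ Θ := tdIterate_mem hcl hw₀ x _
  set g := semiGradient M γ φ (x k) (x (k + 1)) w with hgdef
  have h1 : ‖v - tdIterate M γ φ Θ α w₀ x (k + 1)‖ ≤ ‖v - w - α • g‖ := by
    rw [sub_sub]
    exact norm_sub_proj_le hcl hconv hv _
  have h2 : ‖v - tdIterate M γ φ Θ α w₀ x (k + 1)‖ ^ 2 ≤ ‖v - w - α • g‖ ^ 2 := by gcongr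
  rw [norm_sub_sq_real (v - w), real_inner_smul_right, norm_smul, Real.norm_of_nonneg hα, mul_pow] at h2
  have h3 : α ^ 2 * ‖g‖ ^ 2 ≤ α ^ 2 * F ^ 2 := by
    have := hg w hwΘ (x k) (x (k + 1))
    gcongr
  -- The noise is exactly the error of using the sampled gradient in place of its mean along v - w.
  have h4 : gradientNoise M γ φ π η v (x k) (x (k + 1)) w =
      inner ℝ (meanGradient M γ φ π η w) (v - w) - inner ℝ (v - w) g := by
    rw [gradientNoise, ← hgdef, real_inner_comm g, ← inner_sub_left, ← neg_sub w v, inner_neg_right,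
      ← inner_neg_left, neg_sub]
  have h5 := mul_le_mul_of_nonneg_left
    (hsol.sqNorm_le_inner_meanGradient hγ0 hη w) (by positivity : 0 ≤ 2 * α)
  rw [h4]
  linarith

theorem sqNorm_tdAverage_le (hη : ∀ x, 0 ≤ η x) (x : ℕ → S × A) {K : ℕ} (hK : 0 < K) :
    sqNorm η (linQ φ v - linQ φ (tdAverage M γ φ Θ α w₀ x K)) ≤
      (1 / (K : ℝ)) * ∑ k ∈ Finset.range K,
        sqNorm η (linQ φ v - linQ φ (tdIterate M γ φ Θ α w₀ x k)) := by
  convert sqNorm_average_le hη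
    (fun k => linQ φ v - linQ φ (tdIterate M γ φ Θ α w₀ x k)) hK using 2
  funext y
  have hK' : (K : ℝ) ≠ 0 := by positivity
  simp only [Pi.sub_apply, tdAverage, linQ, real_inner_smul_left, sum_inner,
    Finset.sum_sub_distrib, Finset.sum_const, Finset.card_range, nsmul_eq_mul, mul_sub]
  field_simp

variable {Ω : Type*} [MeasurableSpace Ω] {μ : Measure Ω}
  [IsProbabilityMeasure μ] {X : ℕ → Ω → S × A} {m r : ℝ}

theorem integrable_gradientNoise (hX : IsMarkovChain μ X (chainMatrix M π)) {n k : ℕ}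
    (hn : n ≤ k) :
    Integrable (fun ω => gradientNoise M γ φ π η v (X k ω) (X (k + 1) ω)
      (tdIterate M γ φ Θ α w₀ (fun t => X t ω) n)) μ := by
  refine hX.integrable (n := k + 1)
    (f := fun x => gradientNoise M γ φ π η v (x k) (x (k + 1)) (tdIterate M γ φ Θ α w₀ x n)) ?_
  intro x x' h
  have h1 : tdIterate M γ φ Θ α w₀ x n = tdIterate M γ φ Θ α w₀ x' n :=
    dependsOn_tdIterate n fun t ht => h t (Set.Iic_subset_Iic.2 (by omega) ht)
  simp only [h1, h k (Set.mem_Iic.2 k.le_succ), h (k + 1) (Set.mem_Iic.2 le_rfl)]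

/-- The mean noise at an iterate is controlled by the mixing over the last `j` steps. -/
theorem integral_gradientNoise_le [DecidableEq S] [DecidableEq A] (hγ0 : 0 ≤ γ) (hγ1 : γ ≤ 1) (hφ : ∀ x, ‖φ x‖ ≤ 1)
    (hη : IsStationary (chainMatrix M π) η)
    (hmix : MixesGeometrically (chainMatrix M π) η m r)
    (hX : IsMarkovChain μ X (chainMatrix M π))
    (hcl : IsClosed Θ) (hconv : Convex ℝ Θ) (hw₀ : w₀ ∈ Θ) (hα : 0 ≤ α) (hF : 0 ≤ F)
    (hg : ∀ w ∈ Θ, ∀ x y, ‖semiGradient M γ φ x y w‖ ≤ F) (hd : ∀ w ∈ Θ, ‖w - v‖ ≤ F)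
    (n j : ℕ) :
    ∫ ω, gradientNoise M γ φ π η v (X (n + j) ω) (X (n + j + 1) ω)
      (tdIterate M γ φ Θ α w₀ (fun t => X t ω) (n + j)) ∂μ ≤
      6 * F ^ 2 * α * j + 4 * F ^ 2 * (m * r ^ j) := by
  have hmem := tdIterate_mem (M := M) (γ := γ) (φ := φ) (α := α) hcl hw₀
  -- Only the iterate goes back to time n; the transition stays at time n + j.
  have h1 : ∀ ω, gradientNoise M γ φ π η v (X (n + j) ω) (X (n + j + 1) ω)
      (tdIterate M γ φ Θ α w₀ (fun t => X t ω) (n + j)) ≤ 6 * F ^ 2 * α * j +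
      gradientNoise M γ φ π η v (X (n + j) ω) (X (n + j + 1) ω)
        (tdIterate M γ φ Θ α w₀ (fun t => X t ω) n) := by
    intro ω
    have ha := gradientNoise_sub_le hγ0 hγ1 hφ hη
      (hg _ (hmem (fun t => X t ω) (n + j))) (hd _ (hmem (fun t => X t ω) n))
      (X (n + j) ω) (X (n + j + 1) ω)
    have hb := mul_le_mul_of_nonneg_left (norm_tdIterate_add_sub_le hcl hconv hw₀ hα hg
      (fun t => X t ω) n j) (by positivity : 0 ≤ 6 * F)
    linarith
  have hdep : DependsOn (fun (x : ℕ → S × A) y =>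
      gradientNoise M γ φ π η v (x (n + j)) y (tdIterate M γ φ Θ α w₀ x n))
      (Set.Iic (n + j)) := by
    intro x x' h
    have h1 : tdIterate M γ φ Θ α w₀ x n = tdIterate M γ φ Θ α w₀ x' n :=
      dependsOn_tdIterate n fun t ht => h t (Set.Iic_subset_Iic.2 (by omega) ht)
    simp only [h1, h (n + j) (Set.mem_Iic.2 le_rfl)]
  have hdep' : DependsOn (fun (x : ℕ → S × A) z => ∑ y, chainMatrix M π z y *
      gradientNoise M γ φ π η v z y (tdIterate M γ φ Θ α w₀ x n)) (Set.Iic n) := by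
    intro x x' h
    have h1 : tdIterate M γ φ Θ α w₀ x n = tdIterate M γ φ Θ α w₀ x' n := dependsOn_tdIterate n h
    simp only [h1]
  have h2 : ∫ ω, gradientNoise M γ φ π η v (X (n + j) ω) (X (n + j + 1) ω)
        (tdIterate M γ φ Θ α w₀ (fun t => X t ω) n) ∂μ ≤ 4 * F ^ 2 * (m * r ^ j) := by
    -- First average over the next state, then over the j steps since time n, with the old iterate
    -- frozen.
    rw [hX.integral_succ hdep, hX.integral_add j hdep']
    have hint : Integrable (fun ω => ∑ z, (chainMatrix M π ^ j) (X n ω) z *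
        ∑ y, chainMatrix M π z y * gradientNoise M γ φ π η v z y
          (tdIterate M γ φ Θ α w₀ (fun t => X t ω) n)) μ := by
      refine hX.integrable (n := n) (f := fun x => ∑ z, (chainMatrix M π ^ j) (x n) z *
        ∑ y, chainMatrix M π z y * gradientNoise M γ φ π η v z y
          (tdIterate M γ φ Θ α w₀ x n)) ?_
      intro x x' h
      simp only [congrFun (hdep' h), h n (Set.mem_Iic.2 le_rfl)]
    refine (integral_mono hint (integrable_const _) fun ω =>
      sum_gradientNoise_le hη hmix (hg _ (hmem _ n)) (hd _ (hmem _ n)) j (X n ω)).trans_eq ?_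
    simp
  have hi : ∀ i ≤ n + j, Integrable (fun ω => gradientNoise M γ φ π η v (X (n + j) ω)
      (X (n + j + 1) ω) (tdIterate M γ φ Θ α w₀ (fun t => X t ω) i)) μ :=
    fun i hi => integrable_gradientNoise hX hi
  refine (integral_mono (hi _ le_rfl) ((integrable_const _).add (hi _ (Nat.le_add_right n j)))
    h1).trans ?_
  rw [Pi.add_def, integral_add (integrable_const _) (hi _ (Nat.le_add_right n j))]
  simp only [integral_const, probReal_univ, one_smul]
  linarith

end Iterates

/-- An infimum in ℕ is attained once the set is nonempty, which r < 1 guarantees. -/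
theorem mul_pow_mixingTime_le {m r ε : ℝ} (hr0 : 0 ≤ r) (hr1 : r < 1) (hε : 0 < ε) :
    m * r ^ mixingTime m r ε ≤ ε := by
  have h : Filter.Tendsto (fun t : ℕ => m * r ^ t) Filter.atTop (nhds (m * 0)) :=
    (tendsto_pow_atTop_nhds_zero_of_lt_one hr0 hr1).const_mul m
  rw [mul_zero] at h
  obtain ⟨t, ht⟩ := (h.eventually (gt_mem_nhds hε)).exists
  exact Nat.sInf_mem (s := {t : ℕ | m * r ^ t ≤ ε}) ⟨t, ht.le⟩

end TDZero

/-! ### Assembly of the bound. -/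

theorem theorem4 {S A : Type*} [Fintype S] [DecidableEq S] [Fintype A] [DecidableEq A]
    (M : TDZero.MDP S A) (π : TDZero.Policy S A)
    (γ : ℝ) (hγ0 : 0 < γ) (hγ1 : γ < 1)
    (Rmax : ℝ) (hRmax : 0 < Rmax) (hreward : ∀ s a, |M.reward s a| ≤ Rmax)
    (hπ : ∀ s a, 0 < π.prob s a)
    (herg : TDZero.IsErgodic (TDZero.chainMatrix M π))
    (η : S × A → ℝ) (hη : TDZero.IsStationary (TDZero.chainMatrix M π) η)
    (m r : ℝ) (hm : 0 < m) (hr0 : 0 < r) (hr1 : r < 1)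
    (hmix : TDZero.MixesGeometrically (TDZero.chainMatrix M π) η m r)
    (N : ℕ) (φ : S × A → EuclideanSpace ℝ (Fin N))
    (hφrank : LinearIndependent ℝ (fun (n : Fin N) (x : S × A) => φ x n))
    (hφnorm : ∀ x, ‖φ x‖ ^ 2 ≤ 1)
    (R : ℝ) (hR : 0 < R)
    (Θ : Set (EuclideanSpace ℝ (Fin N))) (hΘconv : Convex ℝ Θ) (hΘclosed : IsClosed Θ)
    (hΘR : ∀ w ∈ Θ, ‖w‖ ≤ R)
    (wstar : EuclideanSpace ℝ (Fin N)) (hwstar : wstar ∈ Θ)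
    (hsol : TDZero.IsProjectedBellmanSolution M π γ η φ wstar)
    (w₀ : EuclideanSpace ℝ (Fin N)) (hw₀ : w₀ ∈ Θ)
    {Ω : Type*} [MeasurableSpace Ω] (μ : MeasureTheory.Measure Ω)
    [MeasureTheory.IsProbabilityMeasure μ]
    (X : ℕ → Ω → S × A) (hX : TDZero.IsMarkovChain μ X (TDZero.chainMatrix M π))
    (K : ℕ) (hK : 1 ≤ K) (F : ℝ) (hF : F = Rmax + 2 * R) :
    MeasureTheory.Integrable
      (fun ω => TDZero.sqNorm η (TDZero.linQ φ wstar - TDZero.linQ φ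
        (TDZero.tdAverage M γ φ Θ (1 / Real.sqrt K) w₀ (fun t => X t ω) K))) μ ∧
    ∫ ω, TDZero.sqNorm η (TDZero.linQ φ wstar - TDZero.linQ φ
        (TDZero.tdAverage M γ φ Θ (1 / Real.sqrt K) w₀ (fun t => X t ω) K)) ∂μ ≤
      (‖wstar - w₀‖ ^ 2 +
          F ^ 2 * (17 + 12 * (TDZero.mixingTime m r (1 / Real.sqrt K) : ℝ))) /
          (2 * (1 - γ) * Real.sqrt K) +
        10 * F ^ 2 * m / ((1 - r) * (1 - γ) * K) := by
  have hφ : ∀ x, ‖φ x‖ ≤ 1 := fun x => (pow_le_one_iff_of_nonneg (norm_nonneg _) two_ne_zero).1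
    (hφnorm x)
  have hF0 : 0 < F := by rw [hF]; positivity
  have hg : ∀ w ∈ Θ, ∀ x y, ‖TDZero.semiGradient M γ φ x y w‖ ≤ F := fun w hw x y => by
    rw [hF]
    exact TDZero.norm_semiGradient_le hγ0.le hγ1.le hreward hφ (hΘR w hw) x y
  -- F exceeds 2R, so one constant bounds both the gradients and the distances to w*.
  have hd : ∀ w ∈ Θ, ‖w - wstar‖ ≤ F := fun w hw =>
    (norm_sub_le _ _).trans (by linarith [hΘR w hw, hΘR wstar hwstar])
  have hKpos : (0 : ℝ) < K := by exact_mod_cast hK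
  set s : ℝ := Real.sqrt K with hs
  have hs0 : 0 < s := Real.sqrt_pos.2 hKpos
  have hsK : (K : ℝ) = s ^ 2 := (Real.sq_sqrt hKpos.le).symm
  set α : ℝ := 1 / s with hα
  have hα0 : 0 < α := by positivity
  set τ := TDZero.mixingTime m r α with hτ
  have hmτ : m * r ^ τ ≤ α := TDZero.mul_pow_mixingTime_le hr0.le hr1 hα0
  set w : ℕ → Ω → EuclideanSpace ℝ (Fin N) :=
    fun k ω => TDZero.tdIterate M γ φ Θ α w₀ (fun t => X t ω) k with hw
  set Z : ℕ → Ω → ℝ :=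
    fun k ω => TDZero.gradientNoise M γ φ π η wstar (X k ω) (X (k + 1) ω) (w k ω) with hZ
  have hZint : ∀ k, MeasureTheory.Integrable (Z k) μ := fun k =>
    TDZero.integrable_gradientNoise hX le_rfl
  -- Adding the bounds for k ≥ τ and k ≤ τ gives one valid for all k, so the sum need not be split
  -- at τ.
  have hZle : ∀ k, ∫ ω, Z k ω ∂μ ≤ 6 * F ^ 2 * α * τ + 4 * F ^ 2 * α + 4 * F ^ 2 * m * r ^ k := by
    intro k
    have hrk : 0 ≤ m * r ^ k := by positivity
    have key := TDZero.integral_gradientNoise_le (M := M) (π := π) (η := η) hγ0.le hγ1.le hφ hη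
      hmix hX hΘclosed hΘconv hw₀ hα0.le hF0.le hg hd
    rcases le_total τ k with h | h
    · have := key (k - τ) τ
      rw [Nat.sub_add_cancel h] at this
      refine this.trans ?_
      nlinarith [mul_le_mul_of_nonneg_left hmτ (sq_nonneg F), mul_nonneg (sq_nonneg F) hrk]
    · have := key 0 k
      rw [zero_add] at this
      refine this.trans ?_
      have h' : (k : ℝ) ≤ τ := by exact_mod_cast h
      have h1 : 6 * F ^ 2 * α * k ≤ 6 * F ^ 2 * α * τ := by gcongr
      have h2 : 0 ≤ 4 * F ^ 2 * α := by positivity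
      linarith
  have hgeom : ∑ k ∈ Finset.range K, r ^ k ≤ 1 / (1 - r) := by
    rw [one_div, ← tsum_geometric_of_lt_one hr0.le hr1]
    exact (summable_geometric_of_lt_one hr0.le hr1).sum_le_tsum _ fun k _ => by positivity
  have hZsum : ∑ k ∈ Finset.range K, ∫ ω, Z k ω ∂μ ≤
      K * (6 * F ^ 2 * α * τ + 4 * F ^ 2 * α) + 4 * F ^ 2 * m * (1 / (1 - r)) := by
    refine (Finset.sum_le_sum fun k _ => hZle k).trans ?_
    rw [Finset.sum_add_distrib, ← Finset.mul_sum, Finset.sum_const, Finset.card_range,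
      nsmul_eq_mul]
    gcongr
  have hpath : ∀ ω, TDZero.sqNorm η (TDZero.linQ φ wstar - TDZero.linQ φ
      (TDZero.tdAverage M γ φ Θ α w₀ (fun t => X t ω) K)) ≤
      1 / (2 * α * (1 - γ) * K) * (‖wstar - w₀‖ ^ 2 + K * (α ^ 2 * F ^ 2) +
        2 * α * ∑ k ∈ Finset.range K, Z k ω) := by
    intro ω
    have h1 := Finset.sum_le_sum fun k (_ : k ∈ Finset.range K) =>
      TDZero.sqNorm_le_of_tdStep hγ0.le hη hsol hwstar hΘclosed hΘconv hw₀ hα0.le hg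
        (fun t => X t ω) k
    rw [← Finset.mul_sum, Finset.sum_add_distrib, Finset.sum_add_distrib,
      Finset.sum_range_sub' (fun k =>
        ‖wstar - TDZero.tdIterate M γ φ Θ α w₀ (fun t => X t ω) k‖ ^ 2),
      Finset.sum_const, Finset.card_range, nsmul_eq_mul, ← Finset.mul_sum] at h1
    have hγ' : 0 < 1 - γ := by linarith
    refine (TDZero.sqNorm_tdAverage_le hη.nonneg (fun t => X t ω) hK).trans ?_
    rw [one_div_mul_eq_div, one_div_mul_eq_div, div_le_div_iff₀ hKpos (by positivity)]
    have h2 : ‖wstar - TDZero.tdIterate M γ φ Θ α w₀ (fun t => X t ω) 0‖ = ‖wstar - w₀‖ := rfl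
    rw [h2] at h1
    -- Telescoping leaves -‖w* - w_K‖², which is dropped.
    have h3 := mul_le_mul_of_nonneg_right (h1.trans (add_le_add_left (add_le_add_left
      (sub_le_self _ (sq_nonneg _)) _) _)) hKpos.le
    linarith
  have hint : MeasureTheory.Integrable (fun ω => TDZero.sqNorm η (TDZero.linQ φ wstar -
      TDZero.linQ φ (TDZero.tdAverage M γ φ Θ α w₀ (fun t => X t ω) K))) μ := by
    refine hX.integrable (n := K) (f := fun x => TDZero.sqNorm η (TDZero.linQ φ wstar -
      TDZero.linQ φ (TDZero.tdAverage M γ φ Θ α w₀ x K))) ?_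
    intro x x' h
    have : TDZero.tdAverage M γ φ Θ α w₀ x K = TDZero.tdAverage M γ φ Θ α w₀ x' K :=
      TDZero.dependsOn_tdAverage K h
    simp only [this]
  refine ⟨hint, ?_⟩
  have hsumint : MeasureTheory.Integrable (fun ω => ∑ k ∈ Finset.range K, Z k ω) μ :=
    MeasureTheory.integrable_finsetSum _ fun k _ => hZint k
  refine (MeasureTheory.integral_mono hint (((MeasureTheory.integrable_const _).add
    (hsumint.const_mul (2 * α))).const_mul _) hpath).trans ?_
  rw [MeasureTheory.integral_const_mul]
  simp only [Pi.add_apply]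
  rw [MeasureTheory.integral_add (MeasureTheory.integrable_const _) (hsumint.const_mul _),
    MeasureTheory.integral_const_mul, MeasureTheory.integral_finsetSum _ fun k _ => hZint k]
  simp only [MeasureTheory.integral_const, MeasureTheory.probReal_univ, one_smul]
  have hγ' : 0 < 1 - γ := by linarith
  have hr' : 0 < 1 - r := by linarith
  have hτ0 : (0 : ℝ) ≤ τ := Nat.cast_nonneg _
  have hmain : 1 / (2 * α * (1 - γ) * K) * (‖wstar - w₀‖ ^ 2 + K * (α ^ 2 * F ^ 2) +
      2 * α * ∑ k ∈ Finset.range K, ∫ ω, Z k ω ∂μ) ≤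
      1 / (2 * α * (1 - γ) * K) * (‖wstar - w₀‖ ^ 2 + K * (α ^ 2 * F ^ 2) +
      2 * α * (K * (6 * F ^ 2 * α * τ + 4 * F ^ 2 * α) + 4 * F ^ 2 * m * (1 / (1 - r)))) := by
    gcongr
  refine hmain.trans ?_
  -- Since Kα² = 1, the constant is 9 = 1 + 2·4; the argument yields 9 and 4, where 17 and 10 are
  -- claimed.
  have heq : 1 / (2 * α * (1 - γ) * K) * (‖wstar - w₀‖ ^ 2 + K * (α ^ 2 * F ^ 2) +
      2 * α * (K * (6 * F ^ 2 * α * τ + 4 * F ^ 2 * α) + 4 * F ^ 2 * m * (1 / (1 - r)))) =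
      (‖wstar - w₀‖ ^ 2 + F ^ 2 * (9 + 12 * (τ : ℝ))) / (2 * (1 - γ) * s) +
        4 * F ^ 2 * m / ((1 - r) * (1 - γ) * K) := by
    rw [hsK, hα]
    field_simp
    ring
  rw [heq]
  gcongr <;> norm_num
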